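/- Let $G$ be an abelian group. For $n\in\mathbb{N}=\{0,1,2,\dots\}$ put $G[n]=\{x\in G: nx=0\}$. The Zariski topology $\mathfrak{Z}_G$ of $G$ is the topology whose closed sets are exactly the intersections of arbitrary families of finite unions of sets of the form $g+G[n]$ with $g\in G$ and $n\in\mathbb{N}$. For a topology $\mathcal{T}$ on $G$ and $X\subseteq G$, let $\mathrm{cl}_{\mathcal{T}}(X)$ denote the $\mathcal{T}$-closure of $X$; the Zariski closure of $X$ is $\mathrm{cl}_{\mathfrak{Z}_G}(X)$. A group topology on $G$ is called precompact if the completion of the resulting topological group is compact. Let $\mathfrak{c}=|\mathbb{R}|$. Then the following conditions are equivalent: (i) $|G|\le 2^{\mathfrak{c}}$; (ii) for every subset $X$ of $G$ there exists a precompact Hausdorff group topology $\mathcal{T}_X$ on $G$ such that $\mathrm{cl}_{\mathcal{T}_X}(X)=\mathrm{cl}_{\mathfrak{Z}_G}(X)$; (iii) for every countable family $\mathscr{X}$ of subsets of $G$ there exists a precompact Hausdorff group topology $\mathcal{T}_{\mathscr{X}}$ on $G$ such that $\mathrm{cl}_{\mathcal{T}_{\mathscr{X}}}(X)=\mathrm{cl}_{\mathfrak{Z}_G}(X)$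 for every $X\in\mathscr{X}$. -/

import Mathlib

open Topology

/-- The subgroup `G[n] = {x : n x = 0}` of an abelian group, as a set. -/
def torsionPart (G : Type*) [AddCommGroup G] (n : ℕ) : Set G := {x | n • x = 0}

/-- Elementary algebraic subsets of an abelian group: the sets `g + G[n]` with `g ∈ G`, `n ∈ ℕ`. -/
def IsElementaryAlgebraic {G : Type*} [AddCommGroup G] (S : Set G) : Prop :=
  ∃ (g : G) (n : ℕ), S = (fun x => g + x) '' torsionPart G n

/-- Finite unions of elementary algebraic sets. -/
def IsFiniteUnionElementary {G : Type*} [AddCommGroup G] (S : Set G) : Prop :=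
  ∃ E : Set (Set G), E.Finite ∧ (∀ A ∈ E, IsElementaryAlgebraic A) ∧ S = ⋃₀ E

/-- Algebraic sets: arbitrary intersections of finite unions of elementary algebraic sets. -/
def IsAlgebraicSubset {G : Type*} [AddCommGroup G] (S : Set G) : Prop :=
  ∃ F : Set (Set G), (∀ A ∈ F, IsFiniteUnionElementary A) ∧ S = ⋂₀ F

theorem IsFiniteUnionElementary.isAlgebraicSubset {G : Type*} [AddCommGroup G] {S : Set G}
    (h : IsFiniteUnionElementary S) : IsAlgebraicSubset S :=
  ⟨{S}, by simpa using h, by simp⟩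

theorem isAlgebraicSubset_empty (G : Type*) [AddCommGroup G] :
    IsAlgebraicSubset (∅ : Set G) :=
  IsFiniteUnionElementary.isAlgebraicSubset ⟨∅, Set.finite_empty, by simp, by simp⟩

theorem isAlgebraicSubset_sInter {G : Type*} [AddCommGroup G] (A : Set (Set G))
    (hA : ∀ S ∈ A, IsAlgebraicSubset S) : IsAlgebraicSubset (⋂₀ A) := by
  refine ⟨{B | IsFiniteUnionElementary B ∧ ⋂₀ A ⊆ B}, fun B hB => hB.1, ?_⟩
  apply Set.Subset.antisymm
  · exact Set.subset_sInter fun B hB => hB.2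
  · refine Set.subset_sInter fun S hS => ?_
    obtain ⟨F, hF, rfl⟩ := hA S hS
    refine Set.subset_sInter fun B hB => Set.sInter_subset_of_mem ⟨hF B hB, ?_⟩
    exact (Set.sInter_subset_of_mem hS).trans (Set.sInter_subset_of_mem hB)

theorem IsFiniteUnionElementary.union {G : Type*} [AddCommGroup G] {S T : Set G}
    (hS : IsFiniteUnionElementary S) (hT : IsFiniteUnionElementary T) :
    IsFiniteUnionElementary (S ∪ T) := by
  obtain ⟨E, hE, hE', rfl⟩ := hS
  obtain ⟨F, hF, hF', rfl⟩ := hT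
  exact ⟨E ∪ F, hE.union hF, fun A hA => hA.elim (hE' A) (hF' A), (Set.sUnion_union E F).symm⟩

theorem isAlgebraicSubset_union {G : Type*} [AddCommGroup G] (S : Set G)
    (hS : IsAlgebraicSubset S) (T : Set G) (hT : IsAlgebraicSubset T) :
    IsAlgebraicSubset (S ∪ T) := by
  obtain ⟨E, hE, rfl⟩ := hS
  obtain ⟨F, hF, rfl⟩ := hT
  refine ⟨{C | ∃ A ∈ E, ∃ B ∈ F, C = A ∪ B}, ?_, ?_⟩
  · rintro C ⟨A, hA, B, hB, rfl⟩
    exact (hE A hA).union (hF B hB)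
  · ext x
    simp only [Set.mem_union, Set.mem_sInter, Set.mem_ofPred_eq]
    constructor
    · rintro (h | h) C ⟨A, hA, B, hB, rfl⟩
      · exact Or.inl (h A hA)
      · exact Or.inr (h B hB)
    · intro h
      by_contra hx
      push Not at hx
      obtain ⟨⟨A, hA, hxA⟩, B, hB, hxB⟩ := hx
      exact (h _ ⟨A, hA, B, hB, rfl⟩).elim hxA hxB

/-- The Zariski topology of an abelian group: the topology whose closed sets are exactly the
algebraic subsets. -/
@[reducible] def groupZariskiTopology (G : Type*) [AddCommGroup G] : TopologicalSpace G :=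
  TopologicalSpace.ofClosed {S : Set G | IsAlgebraicSubset S} (isAlgebraicSubset_empty G)
    isAlgebraicSubset_sInter isAlgebraicSubset_union

/-- The Zariski closure of a subset `X` of an abelian group. -/
def zariskiClosure {G : Type*} [AddCommGroup G] (X : Set G) : Set G :=
  closure[groupZariskiTopology G] X

/-- A topological group is precompact if its completion, with respect to its group uniformity,
is compact. (On an abelian group the left and the right uniformity coincide.) -/
def IsPrecompactAddGroup (G : Type*) [AddCommGroup G] [TopologicalSpace G]
    [IsTopologicalAddGroup G] : Prop :=
  letI : UniformSpace G := IsTopologicalAddGroup.rightUniformSpace G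
  CompactSpace (UniformSpace.Completion G)

/-- `T` is a precompact Hausdorff group topology on the abelian group `G`. -/
structure IsPrecompactHausdorffGroupTopology {G : Type*} [AddCommGroup G]
    (T : TopologicalSpace G) : Prop where
  isTopologicalAddGroup : IsTopologicalAddGroup G
  t2Space : T2Space G
  isPrecompact : IsPrecompactAddGroup G

/-! ### Zariski closures and almost torsion sequences. -/

section Zariski

variable {G : Type*} [AddCommGroup G]

/-! Everything rests on almost `n`-torsion sequences. By pigeonhole, the Zariski closure of such a
sequence contains `G[n]`. Conversely, descent along proper divisors covers any `X` by finitely many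
cosets `g + G[n]`, each containing a translate by `g`, with terms in `X`, of an almost `n`-torsion
sequence (`hasAlmostTorsionCover`). So the Zariski closure of `X` is that finite union, and
countably many points of `X` already determine it.

(ii) ⇒ (i): for `X = G` this makes `G` a finite union of cosets of groups `G[n]`, each inside the
Zariski closure of a countable set. In a Hausdorff topology the closure of a countable set has at
most `2 ^ 𝔠` points.

(i) ⇒ (iii): algebraic sets are closed in every Hausdorff group topology, so only the inclusion of
the Zariski closure matters. It suffices to embed `G` in the power of the circle indexed by `ℕ × (ℕ
→ Bool)` so that each of countably many almost `n`-torsion sequences has the whole `n`-torsion of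
the power in its closure (`exists_embedding_mem_closure`). The terms of the sequences generate a
countable subgroup `H`, which embeds in a countable divisible group `E`. A Baire category argument
over families of characters of `E` gives the required independence (`exists_generic_characters`);
the density it needs is the approximation result `IsAlmostTorsion.exists_approx`. The map `H → E`
extends to `G`, and adding characters of `G ⧸ H` restores injectivity without changing anything on
`H`; `𝔠` of them separate points because `|G| ≤ 2 ^ 𝔠`.

(iii) ⇒ (ii) is the case of a single set. -/

theorem mem_image_add_torsionPart {g z : G} {n : ℕ} :
    z ∈ (fun x => g + x) '' torsionPart G n ↔ n • (z - g) = 0 := by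
  constructor
  · rintro ⟨x, hx, rfl⟩
    simpa [torsionPart] using hx
  · intro h
    exact ⟨z - g, h, by simp⟩

theorem isFiniteUnionElementary_biUnion {ι : Type*} {s : Set ι} (hs : s.Finite)
    (g : ι → G) (n : ι → ℕ) :
    IsFiniteUnionElementary (⋃ i ∈ s, {z | n i • (z - g i) = 0}) := by
  refine ⟨(fun i => {z | n i • (z - g i) = 0}) '' s, hs.image _, ?_, ?_⟩
  · rintro _ ⟨i, -, rfl⟩
    refine ⟨g i, n i, ?_⟩
    ext z
    exact mem_image_add_torsionPart.symm
  · rw [Set.sUnion_image]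

theorem isClosed_groupZariskiTopology_iff {S : Set G} :
    IsClosed[groupZariskiTopology G] S ↔ IsAlgebraicSubset S := by
  rw [← @isOpen_compl_iff G S (groupZariskiTopology G)]
  change IsAlgebraicSubset Sᶜᶜ ↔ _
  rw [compl_compl]

theorem isAlgebraicSubset_zariskiClosure (X : Set G) : IsAlgebraicSubset (zariskiClosure X) :=
  isClosed_groupZariskiTopology_iff.1 (@isClosed_closure G (groupZariskiTopology G) X)

theorem subset_zariskiClosure (X : Set G) : X ⊆ zariskiClosure X :=
  @subset_closure G (groupZariskiTopology G) X

theorem zariskiClosure_subset {X S : Set G} (hS : IsAlgebraicSubset S) (h : X ⊆ S) :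
    zariskiClosure X ⊆ S :=
  @closure_minimal G (groupZariskiTopology G) X S h (isClosed_groupZariskiTopology_iff.2 hS)

theorem IsElementaryAlgebraic.isClosed [TopologicalSpace G] [IsTopologicalAddGroup G] [T2Space G]
    {S : Set G} (hS : IsElementaryAlgebraic S) : IsClosed S := by
  obtain ⟨g, n, rfl⟩ := hS
  have : (fun x => g + x) '' torsionPart G n = {z | n • (z - g) = 0} := by
    ext z
    exact mem_image_add_torsionPart
  rw [this]
  exact isClosed_eq (by fun_prop) continuous_const

theorem IsAlgebraicSubset.isClosed [TopologicalSpace G] [IsTopologicalAddGroup G] [T2Space G]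
    {S : Set G} (hS : IsAlgebraicSubset S) : IsClosed S := by
  obtain ⟨F, hF, rfl⟩ := hS
  refine isClosed_sInter fun A hA => ?_
  obtain ⟨E, hE, hE', rfl⟩ := hF A hA
  rw [Set.sUnion_eq_biUnion]
  exact Set.Finite.isClosed_biUnion hE fun B hB => (hE' B hB).isClosed

theorem closure_subset_zariskiClosure [TopologicalSpace G] [IsTopologicalAddGroup G] [T2Space G]
    (X : Set G) : closure X ⊆ zariskiClosure X :=
  closure_minimal (subset_zariskiClosure X) (isAlgebraicSubset_zariskiClosure X).isClosed

/-- A sequence in `G[n]` is almost `n`-torsion if `k ↦ d • x k` is finite-to-one for every proper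
divisor `d` of `n` (every `d ≥ 1` when `n = 0`). -/
structure IsAlmostTorsion (n : ℕ) (x : ℕ → G) : Prop where
  nsmul_eq_zero : ∀ k, n • x k = 0
  finite : ∀ d, d ∣ n → d ≠ n → ∀ g, {k | d • x k = g}.Finite

theorem IsAlmostTorsion.map {H : Type*} [AddCommGroup H] {n : ℕ} {x : ℕ → G}
    (hx : IsAlmostTorsion n x) {f : G →+ H} (hf : Function.Injective f) :
    IsAlmostTorsion n (fun k => f (x k)) := by
  refine ⟨fun k => by rw [← map_nsmul, hx.nsmul_eq_zero, map_zero], fun d hd hdn g => ?_⟩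
  rcases Set.eq_empty_or_nonempty {k | d • f (x k) = g} with h | ⟨l, hl⟩
  · rw [h]; exact Set.finite_empty
  · refine (hx.finite d hd hdn (d • x l)).subset fun k hk => hf ?_
    rw [Set.mem_ofPred_eq] at hk hl
    rw [map_nsmul, map_nsmul, hk, hl]

theorem IsAlmostTorsion.torsionPart_subset_zariskiClosure {n : ℕ} {x : ℕ → G}
    (hx : IsAlmostTorsion n x) : torsionPart G n ⊆ zariskiClosure (Set.range x) := by
  obtain ⟨F, hF, hXF⟩ := isAlgebraicSubset_zariskiClosure (Set.range x)
  rw [hXF]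
  refine Set.subset_sInter fun A hA => ?_
  have hxA : Set.range x ⊆ A :=
    (subset_zariskiClosure _).trans (hXF.le.trans (Set.sInter_subset_of_mem hA))
  obtain ⟨E, hE, hE', rfl⟩ := hF A hA
  have hex : ∃ B ∈ E, {k | x k ∈ B}.Infinite := by
    by_contra! h
    have : (Set.univ : Set ℕ) ⊆ ⋃ B ∈ E, {k | x k ∈ B} := by
      intro k _
      obtain ⟨B, hB, hk⟩ := hxA ⟨k, rfl⟩
      exact Set.mem_biUnion hB hk
    refine Set.infinite_univ ((hE.biUnion fun B hB => ?_).subset this)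
    exact h B hB
  obtain ⟨B, hB, hinf⟩ := hex
  obtain ⟨g, m, rfl⟩ := hE' B hB
  simp only [mem_image_add_torsionPart] at hinf
  obtain ⟨l, hl⟩ := hinf.nonempty
  -- Differences of terms in the same coset are killed by `m` and `n`, hence by their gcd; were it a
  -- proper divisor of `n`, only finitely many terms could lie there.
  have hnm : n ∣ m := by
    by_contra hnm
    have hd : Nat.gcd m n ≠ n := fun h => hnm (Nat.gcd_eq_right_iff_dvd.1 h)
    refine hinf ((hx.finite _ (Nat.gcd_dvd_right m n) hd (Nat.gcd m n • x l)).subset fun k hk => ?_)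
    have h1 : m • (x k - x l) = 0 := by
      have : x k - x l = (x k - g) - (x l - g) := by abel
      rw [this, smul_sub, hk, hl, sub_zero]
    have h2 : n • (x k - x l) = 0 := by
      rw [smul_sub, hx.nsmul_eq_zero, hx.nsmul_eq_zero, sub_zero]
    have h3 : Nat.gcd m n • (x k - x l) = 0 := by
      rw [← addOrderOf_dvd_iff_nsmul_eq_zero] at h1 h2 ⊢
      exact Nat.dvd_gcd h1 h2
    rwa [smul_sub, sub_eq_zero] at h3
  intro z hz
  refine ⟨_, hB, mem_image_add_torsionPart.2 ?_⟩
  obtain ⟨c, rfl⟩ := hnm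
  have : z - g = (z - x l) + (x l - g) := by abel
  rw [this, smul_add, hl, add_zero, mul_comm, mul_smul, smul_sub, hz, hx.nsmul_eq_zero]
  simp

/-- A set contained in no finite union of cosets of the `G[d]`, `d` a proper divisor of `n`,
contains a translate of an almost `n`-torsion sequence. -/
theorem exists_isAlmostTorsion_of_not_subset {n : ℕ} {Y : Set G} (hY : ∀ y ∈ Y, n • y = 0)
    (h : ∀ s : Set (ℕ × G), s.Finite → (∀ i ∈ s, i.1 ∣ n ∧ i.1 ≠ n) →
      ¬ Y ⊆ ⋃ i ∈ s, {z | i.1 • (z - i.2) = 0}) :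
    ∃ x : ℕ → G, (∀ k, x k ∈ Y) ∧ IsAlmostTorsion n x := by
  classical
  -- Each point carries a level, and only divisors up to that level are handled: `0` has infinitely
  -- many divisors. Levels increase, so every divisor is eventually handled.
  obtain ⟨f, hf, hf'⟩ := exists_seq_of_forall_finset_exists (α := ℕ × G) (fun p => p.2 ∈ Y)
    (fun p q => p.1 < q.1 ∧ ∀ d ≤ q.1, d ∣ n → d ≠ n → d • p.2 ≠ d • q.2) (by
      intro s hs
      set l := s.sup Prod.fst + 1
      set t : Finset (ℕ × G) :=
        ((Finset.range (l + 1)).filter (fun d => d ∣ n ∧ d ≠ n)) ×ˢ s.image Prod.snd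
      have := h t t.finite_toSet (by
        intro i hi
        exact (Finset.mem_filter.1 (Finset.mem_product.1 hi).1).2)
      rw [Set.not_subset] at this
      obtain ⟨y, hyY, hy⟩ := this
      refine ⟨(l, y), hyY, fun p hp => ⟨Nat.lt_succ_of_le (Finset.le_sup (f := Prod.fst) hp), ?_⟩⟩
      intro d hd hdn hdn' he
      refine hy (Set.mem_biUnion (x := (d, p.2)) ?_ ?_)
      · refine Finset.mem_product.2 ⟨Finset.mem_filter.2 ⟨?_, hdn, hdn'⟩,
          Finset.mem_image.2 ⟨p, hp, rfl⟩⟩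
        exact Finset.mem_range.2 (Nat.lt_succ_of_le hd)
      · simp only [Set.mem_ofPred_eq, smul_sub, sub_eq_zero]
        exact he.symm)
  have hmono : StrictMono fun k => (f k).1 := strictMono_nat_of_lt_succ fun k =>
    (hf' k (k + 1) k.lt_succ_self).1
  refine ⟨fun k => (f k).2, hf, fun k => hY _ (hf k), fun d hd hdn g => ?_⟩
  by_contra hinf
  obtain ⟨k, hk, hdk⟩ := Set.Infinite.exists_gt hinf d
  obtain ⟨l, hl, hkl⟩ := Set.Infinite.exists_gt hinf k
  refine (hf' k l hkl).2 d ?_ hd hdn (hk.trans hl.symm)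
  exact (hdk.trans hkl).le.trans hmono.le_apply

/-- `X` is covered by finitely many cosets `g + G[n]`, each of which contains a translate by `g` of
an almost `n`-torsion sequence lying in `X`. -/
def HasAlmostTorsionCover (X : Set G) : Prop :=
  ∃ S : Set (G × ℕ × (ℕ → G)), S.Finite ∧
    (∀ i ∈ S, (∀ k, i.1 + i.2.2 k ∈ X) ∧ IsAlmostTorsion i.2.1 i.2.2) ∧
    X ⊆ ⋃ i ∈ S, {z | i.2.1 • (z - i.1) = 0}

theorem HasAlmostTorsionCover.biUnion {ι : Type*} {s : Set ι} (hs : s.Finite) {Y : ι → Set G}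
    (h : ∀ i ∈ s, HasAlmostTorsionCover (Y i)) : HasAlmostTorsionCover (⋃ i ∈ s, Y i) := by
  classical
  have h' : ∀ i, ∃ S : Set (G × ℕ × (ℕ → G)), i ∈ s → S.Finite ∧
      (∀ j ∈ S, (∀ k, j.1 + j.2.2 k ∈ Y i) ∧ IsAlmostTorsion j.2.1 j.2.2) ∧
      Y i ⊆ ⋃ j ∈ S, {z | j.2.1 • (z - j.1) = 0} := by
    intro i
    by_cases hi : i ∈ s
    · obtain ⟨S, hS⟩ := h i hi
      exact ⟨S, fun _ => hS⟩
    · exact ⟨∅, fun h => absurd h hi⟩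
  choose S hS using h'
  refine ⟨⋃ i ∈ s, S i, hs.biUnion fun i hi => (hS i hi).1, ?_, ?_⟩
  · intro j hj
    obtain ⟨i, hi, hj⟩ := Set.mem_iUnion₂.1 hj
    obtain ⟨h1, h2⟩ := (hS i hi).2.1 j hj
    exact ⟨fun k => Set.mem_biUnion hi (h1 k), h2⟩
  · refine Set.iUnion₂_subset fun i hi => ((hS i hi).2.2).trans ?_
    exact Set.biUnion_subset_biUnion_left (Set.subset_biUnion_of_mem (u := S) hi)

/-- Either finitely many cosets for proper divisors of `n` cover `X` and `ih` applies to the pieces,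
or `X` contains a translated almost `n`-torsion sequence and one coset suffices. -/
theorem hasAlmostTorsionCover_of_subset {n : ℕ}
    (ih : ∀ d, d ∣ n → d ≠ n → ∀ (X : Set G) (g : G), X ⊆ {z | d • (z - g) = 0} →
      HasAlmostTorsionCover X)
    (X : Set G) (g : G) (hX : X ⊆ {z | n • (z - g) = 0}) : HasAlmostTorsionCover X := by
  by_cases h : ∃ s : Set (ℕ × G), s.Finite ∧ (∀ i ∈ s, i.1 ∣ n ∧ i.1 ≠ n) ∧
      (fun z => z - g) '' X ⊆ ⋃ i ∈ s, {z | i.1 • (z - i.2) = 0}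
  · obtain ⟨s, hs, hsn, hsX⟩ := h
    have hXe : X = ⋃ i ∈ s, X ∩ {z | i.1 • (z - (i.2 + g)) = 0} := by
      refine Set.Subset.antisymm (fun z hz => ?_) (Set.iUnion₂_subset fun i _ =>
        Set.inter_subset_left)
      obtain ⟨i, hi, hzi⟩ := Set.mem_iUnion₂.1 (hsX (Set.mem_image_of_mem _ hz))
      refine Set.mem_biUnion hi ⟨hz, ?_⟩
      rw [Set.mem_ofPred_eq] at hzi ⊢
      rw [← hzi]
      congr 1
      abel
    rw [hXe]
    exact HasAlmostTorsionCover.biUnion hs fun i hi =>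
      ih i.1 (hsn i hi).1 (hsn i hi).2 _ _ Set.inter_subset_right
  · push Not at h
    obtain ⟨x, hxY, hx⟩ := exists_isAlmostTorsion_of_not_subset
      (by rintro _ ⟨z, hz, rfl⟩; exact hX hz) h
    refine ⟨{(g, n, x)}, Set.finite_singleton _, ?_, ?_⟩
    · rintro _ rfl
      refine ⟨fun k => ?_, hx⟩
      obtain ⟨z, hz, hzk⟩ := hxY k
      have : g + x k = z := by rw [← hzk]; exact add_sub_cancel g z
      exact this ▸ hz
    · simpa using hX

theorem hasAlmostTorsionCover (X : Set G) : HasAlmostTorsionCover X := by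
  have hpos : ∀ n : ℕ, 0 < n → ∀ (X : Set G) (g : G), X ⊆ {z | n • (z - g) = 0} →
      HasAlmostTorsionCover X := by
    intro n
    induction n using Nat.strong_induction_on with
    | _ n ih =>
      intro hn
      exact hasAlmostTorsionCover_of_subset fun d hd hdn =>
        ih d (lt_of_le_of_ne (Nat.le_of_dvd hn hd) hdn) (Nat.pos_of_dvd_of_pos hd hn)
  -- The proper divisors of `0` are the positive integers, so `n = 0` is the last step of the
  -- induction.
  exact hasAlmostTorsionCover_of_subset (n := 0)
    (fun d _ hd0 => hpos d (Nat.pos_of_ne_zero hd0)) X 0 (by simp)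

theorem HasAlmostTorsionCover.zariskiClosure_subset {S : Set (G × ℕ × (ℕ → G))} (hS : S.Finite)
    {X : Set G} (hX : X ⊆ ⋃ i ∈ S, {z | i.2.1 • (z - i.1) = 0}) :
    zariskiClosure X ⊆ ⋃ i ∈ S, {z | i.2.1 • (z - i.1) = 0} :=
  _root_.zariskiClosure_subset
    (isFiniteUnionElementary_biUnion hS (fun i => i.1) fun i => i.2.1).isAlgebraicSubset hX

end Zariski

/-! ### The cardinality bound. -/

section Cardinality

open Cardinal

/-- A point of the closure is determined by the trace on `X` of its neighbourhood filter, and a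
filter on `X` is a set of subsets of `X`. -/
theorem mk_closure_le_of_countable {Y : Type*} [TopologicalSpace Y] [T2Space Y] {X : Set Y}
    (hX : X.Countable) : #(closure X) ≤ 2 ^ continuum := by
  have hinj : Function.Injective
      (fun z : closure X => (Filter.comap (Subtype.val : X → Y) (𝓝 (z : Y))).sets) := by
    intro z w h
    by_contra hne
    have hd : Disjoint (𝓝 (z : Y)) (𝓝 (w : Y)) := disjoint_nhds_nhds.2 (by simpa using fun h' => hne (Subtype.ext h'))
    have h' := Filter.filter_eq h
    have hb : (Filter.comap (Subtype.val : X → Y) (𝓝 (z : Y))).NeBot :=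
      mem_closure_iff_comap_neBot.1 z.2
    have hd' := Filter.disjoint_comap (m := (Subtype.val : X → Y)) hd
    rw [← h', disjoint_self] at hd'
    exact hb.ne hd'
  calc #(closure X) ≤ #(Set (Set X)) := mk_le_of_injective hinj
    _ = 2 ^ (2 ^ #X : Cardinal) := by rw [mk_set, mk_set]
    _ ≤ 2 ^ (2 ^ ℵ₀ : Cardinal) := by
        have : #X ≤ ℵ₀ := le_aleph0_iff_set_countable.2 hX
        exact power_le_power_left two_ne_zero (power_le_power_left two_ne_zero this)
    _ = 2 ^ continuum := by rw [two_power_aleph0]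

theorem mk_le_of_closure_eq_zariskiClosure {G : Type*} [AddCommGroup G]
    (h : ∀ X : Set G, ∃ T : TopologicalSpace G, T2Space G ∧ closure[T] X = zariskiClosure X) :
    #G ≤ 2 ^ continuum := by
  obtain ⟨S, hS, hS', hcov⟩ := hasAlmostTorsionCover (Set.univ : Set G)
  have hle : ∀ i ∈ S, #{z : G | i.2.1 • (z - i.1) = 0} ≤ 2 ^ continuum := by
    intro i hi
    obtain ⟨T, hT, hTX⟩ := h (Set.range i.2.2)
    have h1 : #{z : G | i.2.1 • (z - i.1) = 0} ≤ #(torsionPart G i.2.1) :=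
      mk_le_of_injective (f := fun z => ⟨z.1 - i.1, z.2⟩) fun z w hzw => by
        simpa [Subtype.ext_iff] using hzw
    refine h1.trans ((mk_le_mk_of_subset (hS' i hi).2.torsionPart_subset_zariskiClosure).trans ?_)
    rw [← hTX]
    exact mk_closure_le_of_countable (Set.countable_range _)
  have hc : ℵ₀ ≤ (2 : Cardinal) ^ continuum :=
    aleph0_le_continuum.trans (cantor _).le
  calc #G = #(Set.univ : Set G) := mk_univ.symm
    _ ≤ #(⋃ i : S, {z : G | i.1.2.1 • (z - i.1.1) = 0} : Set G) :=
        mk_le_mk_of_subset (by rwa [← Set.biUnion_eq_iUnion S (fun i _ => {z : G | i.2.1 • (z - i.1) = 0})])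
    _ ≤ sum fun i : S => #{z : G | i.1.2.1 • (z - i.1.1) = 0} := mk_iUnion_le_sum_mk
    _ ≤ sum fun _ : S => (2 : Cardinal) ^ continuum := sum_le_sum _ _ fun i => hle i i.2
    _ = #S * 2 ^ continuum := by rw [sum_const']
    _ ≤ 2 ^ continuum * 2 ^ continuum := by
        gcongr
        exact (lt_aleph0_iff_set_finite.2 hS).le.trans hc
    _ = 2 ^ continuum := mul_eq_self hc

end Cardinality

/-! ### Extending homomorphisms into divisible groups. -/

section Extension

variable {A B C : Type*} [AddCommGroup A] [AddCommGroup B] [AddCommGroup C] [DivisibleBy C ℤ]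

theorem AddMonoidHom.exists_extension_of_divisibleBy (f : A →+ B) (hf : Function.Injective f)
    (g : A →+ C) : ∃ h : B →+ C, ∀ a, h (f a) = g a := by
  obtain ⟨h, hh⟩ := (Module.Baer.of_divisible C).extension_property_addMonoidHom f hf g
  exact ⟨h, fun a => DFunLike.congr_fun hh a⟩

theorem AddMonoidHom.exists_apply_eq_of_addOrderOf_nsmul_eq_zero (x : A) (s : C)
    (h : addOrderOf x • s = 0) : ∃ η : A →+ C, η x = s := by
  -- `ZMod 0` is `ℤ`, so infinite order needs no separate case.
  let f : ZMod (addOrderOf x) →+ A :=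
    ZMod.lift _ ⟨zmultiplesHom A x, by simp [addOrderOf_nsmul_eq_zero]⟩
  let g : ZMod (addOrderOf x) →+ C := ZMod.lift _ ⟨zmultiplesHom C s, by simpa using h⟩
  have hf : Function.Injective f := by
    refine (ZMod.lift_injective _).2 fun m hm => ?_
    rw [ZMod.intCast_zmod_eq_zero_iff_dvd]
    exact addOrderOf_dvd_iff_zsmul_eq_zero.2 (by simpa using hm)
  obtain ⟨η, hη⟩ := exists_extension_of_divisibleBy f hf g
  refine ⟨η, ?_⟩
  have h1 : f ((1 : ℤ) : ZMod _) = x := by simp only [f, ZMod.lift_coe]; simp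
  have h2 : g ((1 : ℤ) : ZMod _) = s := by simp only [g, ZMod.lift_coe]; simp
  rw [← h1, hη, h2]

end Extension

/-! ### Finitely generated abelian groups. -/

section FinitelyGenerated

variable {P : Type*} [AddCommGroup P] [AddGroup.FG P]

theorem AddGroup.FG.exists_equiv_free_prod_finite :
    ∃ (r : ℕ) (D : Type) (_ : AddCommGroup D) (_ : Finite D), Nonempty (P ≃+ (Fin r →₀ ℤ) × D) := by
  classical
  obtain ⟨r, ι, _, p, hp, e, ⟨f⟩⟩ := AddCommGroup.equiv_free_prod_directSum_zmod P
  have : ∀ i, NeZero (p i ^ e i) := fun i => ⟨pow_ne_zero _ (hp i).ne_zero⟩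
  exact ⟨r, _, inferInstance,
    Finite.of_equiv _ (DirectSum.addEquivProd fun i => ZMod (p i ^ e i)).symm.toEquiv, ⟨f⟩⟩

theorem AddGroup.FG.finite_setOf_nsmul_eq_zero {n : ℕ} (hn : n ≠ 0) :
    {z : P | n • z = 0}.Finite := by
  obtain ⟨r, D, _, _, ⟨f⟩⟩ := AddGroup.FG.exists_equiv_free_prod_finite (P := P)
  refine Set.Finite.of_finite_image (f := f) ?_ f.injective.injOn
  refine ((Set.finite_singleton (0 : Fin r →₀ ℤ)).prod (Set.finite_univ (α := D))).subset ?_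
  rintro _ ⟨z, hz, rfl⟩
  have h : n • f z = 0 := by rw [← map_nsmul, hz, map_zero]
  refine ⟨?_, trivial⟩
  have h1 : n • (f z).1 = 0 := congrArg Prod.fst h
  exact (smul_eq_zero.1 h1).resolve_left hn

theorem AddGroup.FG.exists_hom_int_infinite_image {S : Set P} (hS : S.Infinite) :
    ∃ l : P →+ ℤ, (l '' S).Infinite := by
  obtain ⟨r, D, _, _, ⟨f⟩⟩ := AddGroup.FG.exists_equiv_free_prod_finite (P := P)
  by_contra! h
  refine hS (Set.Finite.of_finite_image (f := fun z => ((fun i => (f z).1 i), (f z).2)) ?_ ?_)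
  · refine ((Set.Finite.pi' (t := fun i => (fun z => (f z).1 i) '' S) fun i => ?_).prod
      (Set.finite_univ (α := D))).subset ?_
    · exact h (((Finsupp.applyAddHom i).comp (AddMonoidHom.fst _ _)).comp f.toAddMonoidHom)
    · rintro _ ⟨z, hz, rfl⟩
      exact ⟨fun i => ⟨z, hz, rfl⟩, trivial⟩
  · intro z _ w _ hzw
    simp only [Prod.mk.injEq] at hzw
    exact f.injective (Prod.ext (DFunLike.coe_injective hzw.1) hzw.2)

end FinitelyGenerated

/-! ### Torsion points of the circle. -/

theorem UnitAddCircle.norm_coe_le_abs (t : ℝ) : ‖(t : UnitAddCircle)‖ ≤ |t| := by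
  rw [UnitAddCircle.norm_eq]
  simpa using round_le t 0

theorem UnitAddCircle.exists_nsmul_eq_zero_dist_lt (s : UnitAddCircle) {d : ℕ} {ε : ℝ}
    (hε : 0 < ε) (hd : d = 0 ∨ 1 / (d : ℝ) < ε) :
    ∃ s' : UnitAddCircle, d • s' = 0 ∧ dist s' s < ε := by
  rcases Nat.eq_zero_or_pos d with rfl | hpos
  · exact ⟨s, zero_smul _ _, by simpa using hε⟩
  have hd' : 1 / (d : ℝ) < ε := hd.resolve_left hpos.ne'
  obtain ⟨r, rfl⟩ := QuotientAddGroup.mk_surjective s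
  have hdR : (0 : ℝ) < d := by exact_mod_cast hpos
  refine ⟨((⌊r * d⌋ / d : ℝ) : UnitAddCircle), ?_, ?_⟩
  · rw [← AddCircle.coe_nsmul, nsmul_eq_mul, mul_div_cancel₀ _ hdR.ne']
    exact (AddCircle.coe_eq_zero_iff (1 : ℝ)).2 ⟨⌊r * d⌋, by simp⟩
  · rw [dist_eq_norm]
    refine lt_of_le_of_lt ?_ hd'
    refine (UnitAddCircle.norm_coe_le_abs (⌊r * d⌋ / d - r)).trans ?_
    rw [abs_sub_comm, abs_le]
    have h1 := Int.floor_le (r * d)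
    have h2 := (Int.lt_floor_add_one (r * d)).le
    constructor
    · have : (0:ℝ) ≤ r - ⌊r * d⌋ / d := by rw [sub_nonneg, div_le_iff₀ hdR]; exact h1
      have : (0:ℝ) < 1 / d := by positivity
      linarith
    · rw [sub_le_iff_le_add, ← add_div, le_div_iff₀ hdR]
      linarith

/-! ### Approximating prescribed character values. -/

section Approximation

variable {E : Type*} [AddCommGroup E]

/-- Adding a character of `E ⧸ P` leaves `χ₀` unchanged on `P` and can shift its value at `x` by any
`d`-torsion point. -/
theorem exists_hom_eq_on_of_addOrderOf (P : AddSubgroup E) (x : E) {d : ℕ}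
    (hd : addOrderOf (x : E ⧸ P) = d) (χ₀ : E →+ UnitAddCircle) (y : UnitAddCircle) {ε : ℝ}
    (h : ∃ s, d • s = 0 ∧ dist s (y - χ₀ x) < ε) :
    ∃ χ : E →+ UnitAddCircle, (∀ f ∈ P, χ f = χ₀ f) ∧ dist (χ x) y < ε := by
  obtain ⟨s, hs, hsy⟩ := h
  obtain ⟨η, hη⟩ := AddMonoidHom.exists_apply_eq_of_addOrderOf_nsmul_eq_zero (x : E ⧸ P) s
    (by rw [hd, hs])
  refine ⟨χ₀ + η.comp (QuotientAddGroup.mk' P), fun f hf => ?_, ?_⟩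
  · simp [(QuotientAddGroup.eq_zero_iff f).2 hf]
  · have : (χ₀ + η.comp (QuotientAddGroup.mk' P)) x = χ₀ x + s := by simp [hη]
    rw [this]
    rw [dist_eq_norm] at hsy ⊢
    convert hsy using 2
    abel

/-- A smaller order `d` puts `d • x k` in the finite `n`-torsion of `P`, which happens for finitely
many `k` only. -/
theorem IsAlmostTorsion.exists_addOrderOf_mk_eq {n : ℕ} (hn : n ≠ 0) {x : ℕ → E}
    (hx : IsAlmostTorsion n x) (P : AddSubgroup E) [AddGroup.FG P] :
    ∃ k, addOrderOf (x k : E ⧸ P) = n := by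
  have hfin : (⋃ d ∈ (n.properDivisors : Set ℕ), ⋃ g ∈ {z : P | n • z = 0},
      {k | d • x k = g}).Finite := by
    refine (Finset.finite_toSet _).biUnion fun d hd =>
      (AddGroup.FG.finite_setOf_nsmul_eq_zero hn).biUnion fun g _ => ?_
    have := Nat.mem_properDivisors.1 hd
    exact hx.finite d this.1 this.2.ne g
  obtain ⟨k, hk⟩ := hfin.exists_notMem
  refine ⟨k, ?_⟩
  by_contra hne
  have hdvd : addOrderOf (x k : E ⧸ P) ∣ n := by
    rw [addOrderOf_dvd_iff_nsmul_eq_zero, ← QuotientAddGroup.mk_nsmul, hx.nsmul_eq_zero]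
    rfl
  have hmem : addOrderOf (x k : E ⧸ P) • x k ∈ P := by
    rw [← QuotientAddGroup.eq_zero_iff, QuotientAddGroup.mk_nsmul, addOrderOf_nsmul_eq_zero]
  refine hk (Set.mem_biUnion (Nat.mem_properDivisors.2
    ⟨hdvd, lt_of_le_of_ne (Nat.le_of_dvd (Nat.pos_of_ne_zero hn) hdvd) hne⟩)
    (Set.mem_biUnion (x := (⟨_, hmem⟩ : P)) ?_ rfl))
  refine Subtype.ext ?_
  change n • (addOrderOf (x k : E ⧸ P) • x k) = 0
  rw [smul_comm, hx.nsmul_eq_zero, smul_zero]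

/-- The points `D • x k` form an infinite subset of `P`, so some homomorphism `P → ℤ` is unbounded
on them; it extends to `E` with values in the divisible group `ℝ`. -/
theorem exists_hom_real_large {x : ℕ → E} (hx : IsAlmostTorsion 0 x) (P : AddSubgroup E)
    [AddGroup.FG P] {D : ℕ} (hD : D ≠ 0) (hDP : ∀ k, D • x k ∈ P) (F : Finset E) (c : ℝ) :
    ∃ (L : E →+ ℝ) (k : ℕ), 0 < |L (x k)| ∧ ∀ f ∈ F, c * |L f| < |L (x k)| := by
  have hS : (Set.range fun k => (⟨D • x k, hDP k⟩ : P)).Infinite := by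
    intro hfin
    have : (⋃ g ∈ Set.range fun k => (⟨D • x k, hDP k⟩ : P), {k | D • x k = g}).Finite :=
      hfin.biUnion fun g _ => hx.finite D (dvd_zero D) hD g
    obtain ⟨k, hk⟩ := this.exists_notMem
    exact hk (Set.mem_biUnion (Set.mem_range_self k) rfl)
  obtain ⟨l, hl⟩ := AddGroup.FG.exists_hom_int_infinite_image hS
  obtain ⟨L, hL⟩ := AddMonoidHom.exists_extension_of_divisibleBy P.subtype P.subtype_injective
    ((Int.castAddHom ℝ).comp l)
  obtain ⟨B, hB⟩ : ∃ B : ℝ, ∀ f ∈ F, c * |L f| ≤ B := by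
    obtain ⟨B, hB⟩ := (F.image fun f => c * |L f|).exists_le
    exact ⟨B, fun f hf => hB _ (Finset.mem_image_of_mem _ hf)⟩
  have hDR : (0 : ℝ) < D := by exact_mod_cast Nat.pos_of_ne_zero hD
  set M : ℤ := ⌈D * max B 0⌉
  obtain ⟨_, ⟨_, ⟨k, rfl⟩, rfl⟩, hk⟩ := (hl.sdiff (Set.finite_Icc (-M) M)).nonempty
  have hLk : D * L (x k) = l ⟨D • x k, hDP k⟩ := by
    have := hL ⟨D • x k, hDP k⟩
    simpa using this
  have hlt : max B 0 < |L (x k)| := by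
    have h1 : M < |l ⟨D • x k, hDP k⟩| := by
      by_contra! h
      exact hk (abs_le.1 h)
    have h2 : (M : ℝ) < |(l ⟨D • x k, hDP k⟩ : ℝ)| := by exact_mod_cast h1
    rw [← hLk, abs_mul, abs_of_pos hDR] at h2
    exact lt_of_mul_lt_mul_left ((Int.le_ceil _).trans_lt h2) hDR.le
  exact ⟨L, k, (le_max_right _ _).trans_lt hlt,
    fun f hf => (hB f hf).trans_lt ((le_max_left _ _).trans_lt hlt)⟩

theorem exists_hom_of_hom_real {x : E} {F : Finset E} {ε : ℝ} (L : E →+ ℝ)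
    (hL : 0 < |L x|) (hLF : ∀ f ∈ F, |L f| < ε * |L x|)
    (χ₀ : E →+ UnitAddCircle) (y : UnitAddCircle) :
    ∃ χ : E →+ UnitAddCircle, (∀ f ∈ F, dist (χ f) (χ₀ f) < ε) ∧ χ x = y := by
  obtain ⟨r, hr, hry⟩ : ∃ r : ℝ, |r| ≤ 1 ∧ (r : UnitAddCircle) = y - χ₀ x := by
    obtain ⟨r, hr⟩ := QuotientAddGroup.mk_surjective (y - χ₀ x)
    refine ⟨Int.fract r, ?_, ?_⟩
    · rw [abs_of_nonneg (Int.fract_nonneg r)]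
      exact (Int.fract_lt_one r).le
    · rw [← hr]
      exact AddCircle.coe_fract r
  let t : ℝ := r / L x
  let η : E →+ UnitAddCircle :=
    (QuotientAddGroup.mk' (AddSubgroup.zmultiples (1 : ℝ))).comp ((AddMonoidHom.mulLeft t).comp L)
  have hη : ∀ e, η e = ((t * L e : ℝ) : UnitAddCircle) := fun e => rfl
  refine ⟨χ₀ + η, fun f hf => ?_, ?_⟩
  · rw [dist_eq_norm, AddMonoidHom.add_apply, add_sub_cancel_left, hη]
    refine (UnitAddCircle.norm_coe_le_abs _).trans_lt ?_
    rw [abs_mul, abs_div, div_mul_eq_mul_div, div_lt_iff₀ hL]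
    exact (mul_le_of_le_one_left (abs_nonneg _) hr).trans_lt (hLF f hf)
  · rw [AddMonoidHom.add_apply, hη, div_mul_cancel₀ _ (abs_pos.1 hL), hry]
    abel

/-- Characters of `E` that are prescribed approximately on a finite set `F` can be prescribed
approximately at some term of an almost `n`-torsion sequence too; the term depends on `F` and the
accuracy only. -/
theorem IsAlmostTorsion.exists_approx {n : ℕ} {x : ℕ → E} (hx : IsAlmostTorsion n x)
    (F : Finset E) {ε : ℝ} (hε : 0 < ε) :
    ∃ k, ∀ (χ₀ : E →+ UnitAddCircle) (y : UnitAddCircle), n • y = 0 →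
      ∃ χ : E →+ UnitAddCircle, (∀ f ∈ F, dist (χ f) (χ₀ f) < ε) ∧ dist (χ (x k)) y < ε := by
  let P : AddSubgroup E := AddSubgroup.closure F
  have hFP : ∀ f ∈ F, f ∈ P := fun f hf => AddSubgroup.subset_closure hf
  have hPfg : AddGroup.FG P := AddGroup.closure_finset_fg F
  have key : ∀ k, (∀ (χ₀ : E →+ UnitAddCircle) (y : UnitAddCircle), n • y = 0 →
      ∃ s, addOrderOf (x k : E ⧸ P) • s = 0 ∧ dist s (y - χ₀ (x k)) < ε) →
      ∀ (χ₀ : E →+ UnitAddCircle) (y : UnitAddCircle), n • y = 0 →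
      ∃ χ : E →+ UnitAddCircle, (∀ f ∈ F, dist (χ f) (χ₀ f) < ε) ∧ dist (χ (x k)) y < ε := by
    intro k h χ₀ y hy
    obtain ⟨χ, h1, h2⟩ := exists_hom_eq_on_of_addOrderOf P (x k) rfl χ₀ y (h χ₀ y hy)
    exact ⟨χ, fun f hf => by rw [h1 f (hFP f hf), dist_self]; exact hε, h2⟩
  by_cases hn : n = 0
  · subst hn
    by_cases h : ∃ k, addOrderOf (x k : E ⧸ P) = 0 ∨ 1 / (addOrderOf (x k : E ⧸ P) : ℝ) < ε
    · obtain ⟨k, hk⟩ := h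
      exact ⟨k, key k fun χ₀ y _ => UnitAddCircle.exists_nsmul_eq_zero_dist_lt _ hε hk⟩
    · push Not at h
      -- All orders modulo `P` are now positive and at most `1 / ε`, so `N!` sends every term into
      -- `P`.
      obtain ⟨N, hN⟩ := exists_nat_ge (1 / ε)
      have hDP : ∀ k, N.factorial • x k ∈ P := by
        intro k
        have h1 : addOrderOf (x k : E ⧸ P) ≤ N := by
          have hpos : (0 : ℝ) < addOrderOf (x k : E ⧸ P) := by
            exact_mod_cast Nat.pos_of_ne_zero (h k).1
          have := (le_div_comm₀ hε hpos).1 (h k).2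
          exact_mod_cast this.trans hN
        rw [← QuotientAddGroup.eq_zero_iff, QuotientAddGroup.mk_nsmul,
          ← addOrderOf_dvd_iff_nsmul_eq_zero]
        exact Nat.dvd_factorial (Nat.pos_of_ne_zero (h k).1) h1
      obtain ⟨L, k, hk, hLF⟩ := exists_hom_real_large hx P N.factorial_ne_zero hDP F (1 / ε)
      refine ⟨k, fun χ₀ y _ => ?_⟩
      obtain ⟨χ, h1, h2⟩ := exists_hom_of_hom_real (ε := ε) L hk (fun f hf => by
        have := hLF f hf
        rwa [div_mul_eq_mul_div, one_mul, div_lt_iff₀ hε, mul_comm] at this) χ₀ y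
      exact ⟨χ, h1, by rw [h2, dist_self]; exact hε⟩
  · obtain ⟨k, hk⟩ := hx.exists_addOrderOf_mk_eq hn P
    refine ⟨k, key k fun χ₀ y hy => ⟨y - χ₀ (x k), ?_, by rw [dist_self]; exact hε⟩⟩
    rw [hk, smul_sub, hy, ← map_nsmul, hx.nsmul_eq_zero, map_zero, sub_zero]

end Approximation

/-! ### Truncation on Cantor space. -/

section Truncation

/-- Replace the coordinates of index at least `N` by `false`. -/
def boolTrunc (N : ℕ) (a : ℕ → Bool) : ℕ → Bool := fun j => if j < N then a j else false

theorem boolTrunc_apply_of_lt {N j : ℕ} (h : j < N) (a : ℕ → Bool) : boolTrunc N a j = a j :=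
  if_pos h

/-- The composite factors through a finite discrete space, so arbitrary pointwise choices become
continuous. -/
theorem continuous_comp_boolTrunc {Y : Type*} [TopologicalSpace Y] (N : ℕ) (f : (ℕ → Bool) → Y) :
    Continuous fun a => f (boolTrunc N a) := by
  let ext : (Fin N → Bool) → (ℕ → Bool) := fun s j => if h : j < N then s ⟨j, h⟩ else false
  have h : (fun a => f (boolTrunc N a)) = (fun s => f (ext s)) ∘ fun a (j : Fin N) => a j := by
    funext a
    change f _ = f _
    congr 1
  rw [h]
  exact continuous_of_discreteTopology.comp (by fun_prop)

theorem eventually_dist_boolTrunc_lt {Y : Type*} [PseudoMetricSpace Y] (f : C(ℕ → Bool, Y)) {ε : ℝ}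
    (hε : 0 < ε) : ∀ᶠ N in Filter.atTop, ∀ a, dist (f (boolTrunc N a)) (f a) < ε := by
  have h : TendstoUniformly (fun N a => f (boolTrunc N a)) f Filter.atTop := by
    rw [← tendstoLocallyUniformly_iff_tendstoUniformly_of_compactSpace,
      tendstoLocallyUniformly_iff_forall_tendsto]
    intro a
    have h1 : Filter.Tendsto (fun y : ℕ × (ℕ → Bool) => boolTrunc y.1 y.2)
        (Filter.atTop ×ˢ 𝓝 a) (𝓝 a) := by
      rw [tendsto_pi_nhds]
      intro j
      have h2 : Filter.Tendsto (fun y : ℕ × (ℕ → Bool) => y.2 j)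
          (Filter.atTop ×ˢ 𝓝 a) (𝓝 (a j)) :=
        (((continuous_apply j).tendsto a)).comp Filter.tendsto_snd
      refine h2.congr' ?_
      filter_upwards [Filter.tendsto_fst.eventually (Filter.eventually_gt_atTop j)] with y hy
      exact (boolTrunc_apply_of_lt hy y.2).symm
    have h3 := (f.continuous.tendsto a).comp h1
    have h4 : Filter.Tendsto (fun y : ℕ × (ℕ → Bool) => f y.2) (Filter.atTop ×ˢ 𝓝 a) (𝓝 (f a)) :=
      (f.continuous.tendsto a).comp Filter.tendsto_snd
    exact (h4.prodMk h3).mono_right (nhds_prod_eq (x := f a) (y := f a) ▸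
      nhds_le_uniformity (f a))
  filter_upwards [Metric.tendstoUniformly_iff.1 h ε hε] with N hN a
  rw [dist_comm]
  exact hN a

end Truncation

theorem mem_closure_pi_of_forall_dist_lt {ι Y : Type*} [PseudoMetricSpace Y] {s : Set (ι → Y)}
    {p : ι → Y} (h : ∀ (F : Finset ι) (ε : ℝ), 0 < ε → ∃ q ∈ s, ∀ i ∈ F, dist (q i) (p i) < ε) :
    p ∈ closure s := by
  rw [mem_closure_iff_nhds_basis
    (nhds_pi (a := p) ▸ Filter.hasBasis_pi fun i => Metric.nhds_basis_ball (x := p i))]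
  rintro ⟨I, r⟩ ⟨hI, hr⟩
  obtain ⟨ε, hε, hεr⟩ : ∃ ε > 0, ∀ i ∈ I, ε ≤ r i := by
    rcases I.eq_empty_or_nonempty with rfl | hne
    · exact ⟨1, one_pos, by simp⟩
    · obtain ⟨i, hi, him⟩ := hI.exists_minimalFor r I hne
      refine ⟨r i, hr i hi, fun j hj => ?_⟩
      by_contra! hlt
      exact absurd (him hj hlt.le) (not_le.2 hlt)
  obtain ⟨q, hqs, hq⟩ := h hI.toFinset ε hε
  exact ⟨q, hqs, fun i hi => (hq i (hI.mem_toFinset.2 hi)).trans_le (hεr i hi)⟩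

theorem exists_hom_unitAddCircle_ne_zero {E : Type*} [AddCommGroup E] {e : E} (he : e ≠ 0) :
    ∃ χ : E →+ UnitAddCircle, χ e ≠ 0 := by
  obtain ⟨s, hs, hs0⟩ : ∃ s : UnitAddCircle, addOrderOf e • s = 0 ∧ s ≠ 0 := by
    by_cases h : addOrderOf e = 0
    · refine ⟨((1 / 2 : ℝ) : UnitAddCircle), by rw [h, zero_smul], ?_⟩
      rw [← norm_ne_zero_iff, UnitAddCircle.norm_eq]
      norm_num
    · have h1 := AddCircle.addOrderOf_period_div (p := (1 : ℝ)) (Nat.pos_of_ne_zero h)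
      refine ⟨_, h1 ▸ addOrderOf_nsmul_eq_zero _, fun h0 => he ?_⟩
      rw [h0, addOrderOf_zero] at h1
      exact AddMonoid.addOrderOf_eq_one_iff.1 h1.symm
  obtain ⟨χ, hχ⟩ := AddMonoidHom.exists_apply_eq_of_addOrderOf_nsmul_eq_zero e s hs
  exact ⟨χ, hχ ▸ hs0⟩

/-! ### Generic characters by Baire category. -/

section Generic

variable {E : Type*} [AddCommGroup E]

/-- Sequences of families of characters of `E` depending continuously on a point of Cantor space. -/
def characterFamilies (E : Type*) [AddCommGroup E] :
    Set (ℕ × E → C(ℕ → Bool, UnitAddCircle)) :=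
  {q | ∀ m e e', q (m, e + e') = q (m, e) + q (m, e')}

theorem isClosed_characterFamilies : IsClosed (characterFamilies E) := by
  have : characterFamilies E = ⋂ (m) (e) (e'), {q | q (m, e + e') = q (m, e) + q (m, e')} := by
    ext q
    simp [characterFamilies]
  rw [this]
  refine isClosed_iInter fun m => isClosed_iInter fun e => isClosed_iInter fun e' => ?_
  exact isClosed_eq (by fun_prop) (by fun_prop)

instance [Countable E] : BaireSpace (characterFamilies E) :=
  have := (isClosed_characterFamilies (E := E)).isClosedEmbedding_subtypeVal.IsCompletelyMetrizableSpace
  inferInstance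

/-- The character of `E` given by a member of `characterFamilies E` at an index. -/
def familyChar (q : characterFamilies E) (j : ℕ × (ℕ → Bool)) :
    E →+ UnitAddCircle :=
  AddMonoidHom.mk' (fun e => q.1 (j.1, e) j.2) fun e e' => by rw [q.2]; rfl

theorem dense_characterFamilies {W : Set (characterFamilies E)}
    (h : ∀ (p : characterFamilies E) (F : Finset (ℕ × E)) (ε : ℝ), 0 < ε →
      ∃ q ∈ W, ∀ i ∈ F, dist (q.1 i) (p.1 i) < ε) : Dense W := by
  intro p
  rw [closure_subtype]
  refine mem_closure_pi_of_forall_dist_lt fun F ε hε => ?_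
  obtain ⟨q, hqW, hq⟩ := h p F ε hε
  exact ⟨q.1, ⟨q, hqW, rfl⟩, hq⟩

theorem isOpen_setOf_exists_char_ne_zero (e : E) :
    IsOpen {q : characterFamilies E | ∃ m a, familyChar q (m + 1, a) e ≠ 0} := by
  have : {q : characterFamilies E | ∃ m a, familyChar q (m + 1, a) e ≠ 0} =
      ⋃ (m) (a), {q | q.1 (m + 1, e) a ≠ 0} := by
    ext q
    simp [familyChar]
  rw [this]
  refine isOpen_iUnion fun m => isOpen_iUnion fun a => isOpen_ne_fun ?_ continuous_const
  exact (continuous_eval_const a).comp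
    ((continuous_apply (m + 1, e)).comp continuous_subtype_val)

theorem dense_setOf_exists_char_ne_zero {e : E} (he : e ≠ 0) :
    Dense {q : characterFamilies E | ∃ m a, familyChar q (m + 1, a) e ≠ 0} := by
  obtain ⟨χ, hχ⟩ := exists_hom_unitAddCircle_ne_zero he
  refine dense_characterFamilies fun p F ε hε => ?_
  set l := F.sup Prod.fst
  -- The index `l + 1` exceeds all those in `F`, so it can be overwritten freely.
  refine ⟨⟨fun i => if i.1 = l + 1 then ContinuousMap.const _ (χ i.2) else p.1 i, ?_⟩, ?_, ?_⟩
  · intro m e e'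
    dsimp only
    split_ifs
    · ext
      simp
    · exact p.2 m e e'
  · refine ⟨l, fun _ => false, ?_⟩
    simpa [familyChar] using hχ
  · intro i hi
    have : i.1 ≠ l + 1 := (Nat.lt_succ_of_le (Finset.le_sup (f := Prod.fst) hi)).ne
    simp [this, hε]

/-- A step function on Cantor space, constant on the cylinders of length `N`. -/
def stepFun {N : ℕ} (y : (Fin N → Bool) → UnitAddCircle) : C(ℕ → Bool, UnitAddCircle) :=
  ⟨fun a => y fun j => a j, continuous_of_discreteTopology.comp (by fun_prop)⟩

theorem isOpen_setOf_exists_dist_stepFun_lt (x : ℕ → E) {N : ℕ}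
    (y : Fin N → (Fin N → Bool) → UnitAddCircle) (ε : ℝ) :
    IsOpen {q : characterFamilies E | ∃ k, ∀ m : Fin N,
      dist (q.1 (m, x k)) (stepFun (y m)) < ε} := by
  simp only [Set.ofPred_exists, Set.ofPred_forall]
  refine isOpen_iUnion fun k => isOpen_iInter_of_finite fun m => ?_
  exact isOpen_lt (((continuous_apply _).comp continuous_subtype_val).dist continuous_const)
    continuous_const

theorem dense_setOf_exists_dist_stepFun_lt {n : ℕ} {x : ℕ → E} (hx : IsAlmostTorsion n x) {N : ℕ}
    (y : Fin N → (Fin N → Bool) → UnitAddCircle) (hy : ∀ m s, n • y m s = 0) {δ : ℝ}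
    (hδ : 0 < δ) :
    Dense {q : characterFamilies E | ∃ k, ∀ m : Fin N,
      dist (q.1 (m, x k)) (stepFun (y m)) < δ} := by
  classical
  refine dense_characterFamilies fun p F ε hε => ?_
  set r := min (ε / 4) (δ / 2)
  have hr : 0 < r := lt_min (by positivity) (by positivity)
  obtain ⟨k, hk⟩ := hx.exists_approx (F.image Prod.snd) hr
  obtain ⟨M, hMN, hM⟩ : ∃ M, N ≤ M ∧ ∀ i ∈ F, ∀ a, dist (p.1 i (boolTrunc M a)) (p.1 i a) < r :=
    ((Filter.eventually_ge_atTop N).and ((Finset.eventually_all F).2 fun i _ =>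
      eventually_dist_boolTrunc_lt (p.1 i) hr)).exists
  let Y : ℕ → (ℕ → Bool) → UnitAddCircle := fun m a =>
    if h : m < N then y ⟨m, h⟩ fun j => a j else 0
  have hY : ∀ m a, n • Y m a = 0 := by
    intro m a
    simp only [Y]
    split_ifs
    · exact hy _ _
    · exact smul_zero n
  -- One `k` serves all points of Cantor space because it does not depend on the character or the
  -- target.
  choose χ hχ hχ' using fun j : ℕ × (ℕ → Bool) => hk (familyChar p j) (Y j.1 j.2) (hY j.1 j.2)
  refine ⟨⟨fun i => ⟨fun a => χ (i.1, boolTrunc M a) i.2,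
    continuous_comp_boolTrunc M fun a => χ (i.1, a) i.2⟩, ?_⟩, ⟨k, fun m => ?_⟩, fun i hi => ?_⟩
  · intro m e e'
    ext a
    simp
  · rw [ContinuousMap.dist_lt_iff hδ]
    intro a
    refine (lt_of_eq_of_lt ?_ (hχ' (m, boolTrunc M a))).trans_le
      ((min_le_right _ _).trans (by linarith))
    congr 1
    simp only [Y, m.2, dif_pos, stepFun, ContinuousMap.coe_mk]
    congr 1
    funext j
    exact (boolTrunc_apply_of_lt (j.2.trans_le hMN) a).symm
  · refine lt_of_le_of_lt ((ContinuousMap.dist_le (C := r + r) (by positivity)).2 fun a => ?_)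
      (show r + r < ε by
        have : r ≤ ε / 4 := min_le_left _ _
        linarith)
    refine (dist_triangle _ (p.1 i (boolTrunc M a)) _).trans (add_le_add ?_ (hM i hi a).le)
    exact (hχ (i.1, boolTrunc M a) i.2 (Finset.mem_image_of_mem _ hi)).le

theorem eventually_forall_lt_and_injOn_restrict (J : Finset (ℕ × (ℕ → Bool))) :
    ∀ᶠ N in Filter.atTop, (∀ j ∈ J, j.1 < N) ∧ ∀ j ∈ J, ∀ j' ∈ J,
      (∀ l < N, j.2 l = j'.2 l) → j.2 = j'.2 := by
  refine ((Finset.eventually_all J).2 fun j _ => Filter.eventually_gt_atTop j.1).and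
    ((Finset.eventually_all J).2 fun j _ => (Finset.eventually_all J).2 fun j' _ => ?_)
  by_cases h : j.2 = j'.2
  · exact Filter.Eventually.of_forall fun _ _ => h
  · obtain ⟨l, hl⟩ := Function.ne_iff.1 h
    filter_upwards [Filter.eventually_gt_atTop l] with N hN hl'
    exact absurd (hl' l hN) hl

/-- Characters of a countable group, indexed by countably many copies of Cantor space, which are
jointly as independent as possible along countably many almost torsion sequences. -/
theorem exists_generic_characters [Countable E] {ι : Type*} [Countable ι] (n : ι → ℕ)
    (x : ι → ℕ → E) (hx : ∀ i, IsAlmostTorsion (n i) (x i)) :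
    ∃ p : ℕ × (ℕ → Bool) → E →+ UnitAddCircle,
      (∀ e, (∀ m a, p (m + 1, a) e = 0) → e = 0) ∧
      ∀ i (J : Finset (ℕ × (ℕ → Bool))) (y : ℕ × (ℕ → Bool) → UnitAddCircle),
        (∀ j, n i • y j = 0) → ∀ ε > 0, ∃ k, ∀ j ∈ J, dist (p j (x i k)) (y j) < ε := by
  have hne : ∀ i, Nonempty {y : UnitAddCircle // n i • y = 0} := fun i => ⟨⟨0, smul_zero _⟩⟩
  let D : ∀ i, ℕ → {y : UnitAddCircle // n i • y = 0} := fun i => TopologicalSpace.denseSeq _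
  let W : ((Σ _ : ι, Σ N : ℕ, (Fin N → (Fin N → Bool) → ℕ)) ⊕ {e : E // e ≠ 0}) →
      Set (characterFamilies E) := Sum.elim
    (fun w => {q | ∃ k, ∀ m : Fin w.2.1, dist (q.1 (m, x w.1 k))
      (stepFun fun s => (D w.1 (w.2.2 m s)).1) < 1 / ((w.2.1 : ℝ) + 1)})
    (fun e => {q | ∃ m a, familyChar q (m + 1, a) e.1 ≠ 0})
  have hW : Dense (⋂ w, W w) := by
    refine dense_iInter_of_isOpen ?_ ?_
    · rintro (w | e)
      · exact isOpen_setOf_exists_dist_stepFun_lt (x w.1) (fun m s => (D w.1 (w.2.2 m s)).1) _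
      · exact isOpen_setOf_exists_char_ne_zero e.1
    · rintro (w | e)
      · exact dense_setOf_exists_dist_stepFun_lt (hx w.1) (fun m s => (D w.1 (w.2.2 m s)).1)
          (fun m s => (D w.1 (w.2.2 m s)).2) (by positivity)
      · exact dense_setOf_exists_char_ne_zero e.2
  have : Nonempty (characterFamilies E) := ⟨⟨0, fun m e e' => by simp⟩⟩
  obtain ⟨q, hq⟩ := hW.nonempty
  rw [Set.mem_iInter] at hq
  refine ⟨familyChar q, fun e he => ?_, fun i J y hy ε hε => ?_⟩
  · by_contra hne
    obtain ⟨m, a, h⟩ := hq (Sum.inr ⟨e, hne⟩)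
    exact h (he m a)
  · classical
    obtain ⟨N, ⟨hN1, hN2⟩, hNε⟩ := ((eventually_forall_lt_and_injOn_restrict J).and
      ((tendsto_one_div_add_atTop_nhds_zero_nat (𝕜 := ℝ)).eventually
        (gt_mem_nhds (half_pos hε)))).exists
    have hD : ∀ j, ∃ l, dist (D i l).1 (y j) < ε / 2 := by
      intro j
      obtain ⟨l, hl⟩ := (TopologicalSpace.denseRange_denseSeq _).exists_dist_lt
        (⟨y j, hy j⟩ : {y : UnitAddCircle // n i • y = 0}) (half_pos hε)
      exact ⟨l, by rw [dist_comm]; exact hl⟩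
    choose c hc using hD
    -- For this `N` distinct points of `J` lie in distinct cells, so one step function meets all
    -- targets; the default `0` fills the unused cells.
    let z : Fin N → (Fin N → Bool) → ℕ := fun m s =>
      if h : ∃ j ∈ J, j.1 = m ∧ ∀ l : Fin N, j.2 l = s l then c h.choose else 0
    obtain ⟨k, hk⟩ := hq (Sum.inl ⟨i, N, z⟩)
    refine ⟨k, fun j hj => ?_⟩
    have h1 := (ContinuousMap.dist_lt_iff (by positivity)).1 (hk ⟨j.1, hN1 j hj⟩) j.2
    have hex : ∃ j' ∈ J, j'.1 = j.1 ∧ ∀ l : Fin N, j'.2 l = j.2 l := ⟨j, hj, rfl, fun _ => rfl⟩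
    have hz : z ⟨j.1, hN1 j hj⟩ (fun l => j.2 l) = c j := by
      have h3 : hex.choose = j := by
        obtain ⟨h4, h5, h6⟩ := hex.choose_spec
        exact Prod.ext h5 (hN2 _ h4 _ hj fun l hl => h6 ⟨l, hl⟩)
      change (if h : ∃ j' ∈ J, j'.1 = j.1 ∧ ∀ l : Fin N, j'.2 l = j.2 l then c h.choose else 0) = _
      rw [dif_pos hex, h3]
    have h2 : dist (familyChar q j (x i k)) (D i (c j)).1 < 1 / ((N : ℝ) + 1) := by
      rw [← hz]
      exact h1
    linarith [dist_triangle (familyChar q j (x i k)) (D i (c j)).1 (y j), hc j]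

end Generic

/-! ### Separating points by `𝔠` characters. -/

section SeparatingCharacters

open Cardinal

open scoped Classical in
/-- The character of `⨁ b, R` that is the sum of the coordinates lying in a given set, transported
to the circle by `ρ`. -/
noncomputable def partialSum {B R : Type*} [AddCommGroup R] (ρ : R →+ UnitAddCircle) (s : Set B) :
    (B →₀ R) →+ UnitAddCircle :=
  Finsupp.liftAddHom fun b => if b ∈ s then ρ else 0

theorem partialSum_apply_of_inter_support_eq {B R : Type*} [AddCommGroup R]
    (ρ : R →+ UnitAddCircle) {s : Set B} {v : B →₀ R} {b : B} (hb : b ∈ s)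
    (h : ∀ c ∈ v.support, c ∈ s → c = b) : partialSum ρ s v = ρ (v b) := by
  classical
  rw [partialSum, Finsupp.liftAddHom_apply, Finsupp.sum, Finset.sum_eq_single b]
  · rw [if_pos hb]
  · intro c hc hcb
    rw [if_neg fun hcs => hcb (h c hc hcs)]
    rfl
  · intro hb'
    rw [Finsupp.notMem_support_iff.1 hb', map_zero]

theorem exists_finset_forall_inter_ne {B : Type*} {code : B → Set ℝ} (hcode : code.Injective)
    (t : Finset B) (b : B) :
    ∃ F : Finset ℝ, ∀ c ∈ t, (∀ r ∈ F, r ∈ code c ↔ r ∈ code b) → c = b := by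
  classical
  have : ∀ c, ∃ r, c ≠ b → ¬ (r ∈ code c ↔ r ∈ code b) := by
    intro c
    by_cases h : c = b
    · exact ⟨0, fun h' => absurd h h'⟩
    · have h' : code c ≠ code b := fun h' => h (hcode h')
      rw [Ne, Set.ext_iff, not_forall] at h'
      exact h'.imp fun r hr _ => hr
  choose r hr using this
  refine ⟨t.image r, fun c hc h => ?_⟩
  by_contra hne
  exact hr c hne (h _ (Finset.mem_image_of_mem r hc))

/-- The index `(F, F')` sums the coordinates whose code meets `F` in `F'`. A large enough `F`
isolates one coordinate of the support, so finite sets of reals suffice as indices. -/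
theorem exists_characters_of_finsupp {A B R : Type*} [AddCommGroup A] [AddCommGroup R]
    {ρ : R →+ UnitAddCircle} (hρ : Function.Injective ρ) {code : B → Set ℝ}
    (hcode : code.Injective) {f : (B →₀ R) →+ A} (hf : Function.Injective f) :
    ∃ ψ : Finset ℝ × Finset ℝ → A →+ UnitAddCircle, ∀ v ≠ 0, ∃ q, ψ q (f v) ≠ 0 := by
  classical
  choose ψ hψ using fun q : Finset ℝ × Finset ℝ =>
    AddMonoidHom.exists_extension_of_divisibleBy f hf
      (partialSum ρ {b | q.1.filter (· ∈ code b) = q.2})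
  refine ⟨ψ, fun v hv => ?_⟩
  obtain ⟨b, hb⟩ := Finsupp.ne_iff.1 hv
  obtain ⟨F, hF⟩ := exists_finset_forall_inter_ne hcode v.support b
  refine ⟨(F, F.filter (· ∈ code b)), ?_⟩
  have key : partialSum ρ {c | F.filter (· ∈ code c) = F.filter (· ∈ code b)} v = ρ (v b) :=
    partialSum_apply_of_inter_support_eq ρ rfl fun c hc hcs =>
      hF c hc (Finset.filter_inj'.1 hcs)
  rw [hψ]
  change partialSum ρ {c | F.filter (· ∈ code c) = F.filter (· ∈ code b)} v ≠ 0
  rw [key]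
  exact (map_ne_zero_iff ρ hρ).2 hb

variable {A : Type*} [AddCommGroup A] {code : A → Set ℝ}

theorem exists_characters_of_infinite_order (hcode : code.Injective) :
    ∃ ψ : Finset ℝ × Finset ℝ → A →+ UnitAddCircle,
      ∀ a, addOrderOf a = 0 → ∃ q, ψ q a ≠ 0 := by
  obtain ⟨s, hs, hmax⟩ := exists_maximal_linearIndepOn ℤ (id : A → A)
  -- Irrationality of `√2` makes `ρ` injective.
  let ρ : ℤ →+ UnitAddCircle := zmultiplesHom _ ((√2 : ℝ) : UnitAddCircle)
  have hρ : Function.Injective ρ := by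
    refine (injective_iff_map_eq_zero ρ).2 fun m hm => ?_
    have h1 : ((m * √2 : ℝ) : UnitAddCircle) = 0 := by
      have : ρ m = ((m • √2 : ℝ) : UnitAddCircle) := rfl
      rw [← hm, this, zsmul_eq_mul]
    obtain ⟨l, hl⟩ := (AddCircle.coe_eq_zero_iff (1 : ℝ)).1 h1
    by_contra hm0
    exact (irrational_sqrt_two.intCast_mul hm0).ne_int l (by simpa using hl.symm)
  obtain ⟨ψ, hψ⟩ := exists_characters_of_finsupp hρ (hcode.comp Subtype.val_injective)
    (f := (Finsupp.linearCombination ℤ fun b : s => (b : A)).toAddMonoidHom) hs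
  refine ⟨ψ, fun a ha => ?_⟩
  obtain ⟨m, hm, hmem⟩ : ∃ m : ℤ, m ≠ 0 ∧ m • a ∈ Submodule.span ℤ (id '' s) := by
    by_cases has : a ∈ s
    · exact ⟨1, one_ne_zero, by
        rw [one_smul]; exact Submodule.subset_span ⟨a, has, rfl⟩⟩
    · exact hmax a has
  obtain ⟨v, hv⟩ : ∃ v, (Finsupp.linearCombination ℤ fun b : s => (b : A)) v = m • a := by
    rw [← LinearMap.mem_range, Finsupp.range_linearCombination]
    simpa using hmem
  have hv0 : v ≠ 0 := by
    rintro rfl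
    rw [map_zero] at hv
    have := addOrderOf_dvd_iff_zsmul_eq_zero.2 hv.symm
    rw [ha] at this
    exact hm (by simpa using this)
  obtain ⟨q, hq⟩ := hψ v hv0
  refine ⟨q, fun h0 => hq ?_⟩
  change ψ q ((Finsupp.linearCombination ℤ fun b : s => (b : A)) v) = 0
  rw [hv, map_zsmul, h0, smul_zero]

theorem exists_characters_of_zmod_module (hcode : code.Injective) (p : ℕ) [Fact p.Prime]
    {V : Type*} [AddCommGroup V] [Module (ZMod p) V] {f : V →+ A} (hf : Function.Injective f) :
    ∃ ψ : Finset ℝ × Finset ℝ → A →+ UnitAddCircle, ∀ v ≠ 0, ∃ q, ψ q (f v) ≠ 0 := by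
  let b := Module.Basis.ofVectorSpace (ZMod p) V
  obtain ⟨ψ, hψ⟩ := exists_characters_of_finsupp (ZMod.toAddCircle_injective p)
    (hcode.comp (hf.comp b.injective))
    (f := f.comp b.repr.symm.toAddEquiv.toAddMonoidHom) (hf.comp b.repr.symm.injective)
  refine ⟨ψ, fun v hv => ?_⟩
  obtain ⟨q, hq⟩ := hψ (b.repr v) ((map_ne_zero_iff b.repr b.repr.injective).2 hv)
  refine ⟨q, ?_⟩
  simpa using hq

theorem exists_characters_of_prime_order (hcode : code.Injective) (p : ℕ) (hp : p.Prime) :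
    ∃ ψ : Finset ℝ × Finset ℝ → A →+ UnitAddCircle,
      ∀ a, a ≠ 0 → p • a = 0 → ∃ q, ψ q a ≠ 0 := by
  have : Fact p.Prime := ⟨hp⟩
  let S : AddSubgroup A := (nsmulAddMonoidHom p : A →+ A).ker
  have hS : ∀ x : S, p • x = 0 := fun x => Subtype.ext x.2
  let _ : Module (ZMod p) S := AddCommGroup.zmodModule hS
  obtain ⟨ψ, hψ⟩ := exists_characters_of_zmod_module hcode p S.subtype_injective
  exact ⟨ψ, fun a ha hpa => hψ ⟨a, hpa⟩ fun h => ha (congrArg Subtype.val h)⟩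

/-- A group of cardinality at most `2 ^ 𝔠` has a separating family of `𝔠` characters. -/
theorem exists_separating_characters (hA : #A ≤ 2 ^ continuum) :
    ∃ ψ : (ℕ → Bool) → A →+ UnitAddCircle, ∀ a, (∀ k, ψ k a = 0) → a = 0 := by
  obtain ⟨⟨code, hcode⟩⟩ : Nonempty (A ↪ Set ℝ) := by
    rw [← lift_mk_le', mk_set, mk_real]
    simpa using hA
  obtain ⟨ψ₀, hψ₀⟩ := exists_characters_of_infinite_order hcode
  have h' : ∀ p : ℕ, ∃ ψ : Finset ℝ × Finset ℝ → A →+ UnitAddCircle,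
      p.Prime → ∀ a, a ≠ 0 → p • a = 0 → ∃ q, ψ q a ≠ 0 := by
    intro p
    by_cases hp : p.Prime
    · exact (exists_characters_of_prime_order hcode p hp).imp fun ψ h _ => h
    · exact ⟨0, fun h => absurd h hp⟩
  choose ψ hψ using h'
  obtain ⟨σ, hσ⟩ : ∃ σ : (ℕ → Bool) → ℕ × Finset ℝ × Finset ℝ, Function.Surjective σ := by
    have hcard : #(ℕ × Finset ℝ × Finset ℝ) ≤ #(ℕ → Bool) := by
      simp [mk_finset_of_infinite, mk_real]
    obtain ⟨i⟩ := hcard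
    exact ⟨Function.invFun i, Function.invFun_surjective i.injective⟩
  -- Label `0` detects infinite order, and a prime label `p` detects order `p`; a nonzero torsion
  -- element has a multiple of prime order.
  refine ⟨fun k => if (σ k).1 = 0 then ψ₀ (σ k).2 else ψ (σ k).1 (σ k).2, fun a ha => ?_⟩
  have h0 : ∀ q, ψ₀ q a = 0 := fun q => by
    obtain ⟨k, hk⟩ := hσ (0, q)
    simpa [hk] using ha k
  have h1 : ∀ p, p ≠ 0 → ∀ q, ψ p q a = 0 := fun p hp q => by
    obtain ⟨k, hk⟩ := hσ (p, q)
    simpa [hk, hp] using ha k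
  by_contra ha0
  by_cases hord : addOrderOf a = 0
  · obtain ⟨q, hq⟩ := hψ₀ a hord
    exact hq (h0 q)
  · obtain ⟨p, hp, c, hc⟩ := Nat.exists_prime_and_dvd
      (mt AddMonoid.addOrderOf_eq_one_iff.1 ha0)
    have hca : c • a ≠ 0 := by
      intro h
      have h2 := Nat.le_of_dvd (Nat.pos_of_ne_zero fun hc0 => hord (by rw [hc, hc0, mul_zero]))
        (addOrderOf_dvd_iff_nsmul_eq_zero.2 h)
      have hc0 : 0 < c := Nat.pos_of_ne_zero fun hc0 => hord (by rw [hc, hc0, mul_zero])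
      rw [hc] at h2
      exact absurd h2 (not_le.2 (lt_mul_of_one_lt_left hc0 hp.one_lt))
    obtain ⟨q, hq⟩ := hψ p hp (c • a) hca (by rw [← mul_smul, ← hc, addOrderOf_nsmul_eq_zero])
    exact hq (by rw [map_nsmul, h1 p hp.ne_zero, smul_zero])

end SeparatingCharacters

/-! ### Countable divisible extensions. -/

section DivisibleHull

/-- Write `H` as a free abelian group modulo relations and divide the corresponding rational vector
space by the same relations. -/
theorem exists_countable_divisible_extension.{u} (H : Type u) [AddCommGroup H] [Countable H] :
    ∃ (E : Type u) (_ : AddCommGroup E) (_ : Countable E) (_ : DivisibleBy E ℤ) (f : H →+ E),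
      Function.Injective f := by
  let π : (H →₀ ℤ) →+ H := Finsupp.liftAddHom fun h => zmultiplesHom H h
  have hπ : Function.Surjective π := fun h => ⟨Finsupp.single h 1, by simp [π]⟩
  let c : (H →₀ ℤ) →+ (H →₀ ℚ) := Finsupp.mapRange.addMonoidHom (Int.castAddHom ℚ)
  have hc : Function.Injective c := Finsupp.mapRange_injective _ (map_zero _) Int.cast_injective
  let R : AddSubgroup (H →₀ ℚ) := π.ker.map c
  let g : (H →₀ ℤ) →+ (H →₀ ℚ) ⧸ R := (QuotientAddGroup.mk' R).comp c
  have hg : ∀ v, g v = 0 ↔ π v = 0 := by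
    intro v
    change ((c v : (H →₀ ℚ) ⧸ R)) = 0 ↔ _
    rw [QuotientAddGroup.eq_zero_iff]
    constructor
    · rintro ⟨w, hw, hwv⟩
      exact hc hwv ▸ hw
    · exact fun h => ⟨v, h, rfl⟩
  have hsurj : ∀ {n : ℤ}, n ≠ 0 → Function.Surjective (fun a : (H →₀ ℚ) ⧸ R => n • a) := by
    intro n hn a
    obtain ⟨v, rfl⟩ := QuotientAddGroup.mk_surjective a
    refine ⟨(((n : ℚ)⁻¹ • v : H →₀ ℚ) : (H →₀ ℚ) ⧸ R), ?_⟩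
    change n • (((n : ℚ)⁻¹ • v : H →₀ ℚ) : (H →₀ ℚ) ⧸ R) = _
    rw [← QuotientAddGroup.mk_zsmul, ← Int.cast_smul_eq_zsmul ℚ, smul_smul,
      mul_inv_cancel₀ (Int.cast_ne_zero.2 hn), one_smul]
  let f : H →+ (H →₀ ℚ) ⧸ R :=
    AddMonoidHom.liftOfSurjective π hπ ⟨g, fun v hv => (hg v).2 hv⟩
  have hf : ∀ v, f (π v) = g v := AddMonoidHom.liftOfRightInverse_comp_apply _ _ _ _
  refine ⟨(H →₀ ℚ) ⧸ R, inferInstance, QuotientAddGroup.mk_surjective.countable, divisibleByOfSMulRightSurj _ _ hsurj, f, ?_⟩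
  refine (injective_iff_map_eq_zero f).2 fun h hh => ?_
  obtain ⟨v, rfl⟩ := hπ h
  exact (hg v).1 ((hf v).symm.trans hh)

end DivisibleHull

/-! ### The embedding and the induced topology. -/

section Embedding

open Cardinal

/-- A Kronecker–Weyl theorem: a group of cardinality at most `2 ^ 𝔠` embeds in a power of the circle
in such a way that countably many given almost torsion sequences have closures as large as
possible. -/
theorem exists_embedding_mem_closure {G : Type*} [AddCommGroup G] (hG : #G ≤ 2 ^ continuum)
    {ι : Type*} [Countable ι] (n : ι → ℕ) (x : ι → ℕ → G) (hx : ∀ i, IsAlmostTorsion (n i) (x i)) :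
    ∃ j : G →+ (ℕ × (ℕ → Bool) → UnitAddCircle), Function.Injective j ∧
      ∀ i y, n i • y = 0 → y ∈ closure (Set.range fun k => j (x i k)) := by
  let c : (ι × ℕ →₀ ℤ) →+ G := Finsupp.liftAddHom fun t => zmultiplesHom G (x t.1 t.2)
  let H : AddSubgroup G := c.range
  have hxH : ∀ i k, x i k ∈ H := fun i k => ⟨Finsupp.single (i, k) 1, by simp [c]⟩
  have hH : Countable H := c.rangeRestrict_surjective.countable
  obtain ⟨E, _, _, _, f, hf⟩ := exists_countable_divisible_extension H
  have hx' : ∀ i, IsAlmostTorsion (n i) (fun k => f ⟨x i k, hxH i k⟩) := fun i =>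
    IsAlmostTorsion.map (x := fun k => (⟨x i k, hxH i k⟩ : H))
      ⟨fun k => Subtype.ext ((hx i).nsmul_eq_zero k), fun d hd hdn g =>
        ((hx i).finite d hd hdn g).subset fun k hk => congrArg Subtype.val hk⟩ hf
  obtain ⟨p, hp, hp'⟩ := exists_generic_characters n _ hx'
  obtain ⟨r, hr⟩ := AddMonoidHom.exists_extension_of_divisibleBy H.subtype H.subtype_injective f
  obtain ⟨ψ, hψ⟩ := exists_separating_characters (A := G ⧸ H)
    ((mk_le_of_surjective QuotientAddGroup.mk_surjective).trans hG)
  -- The characters of `G ⧸ H` enter only at first index `0`. The other coordinates separate `E`, so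
  -- they force `r g = 0`; the coordinates at `0` then put `g` in `H`, where `r` is the injective
  -- `f`.
  let j : G →+ (ℕ × (ℕ → Bool) → UnitAddCircle) := AddMonoidHom.mk' (fun g t =>
    p t (r g) + if t.1 = 0 then ψ t.2 (g : G ⧸ H) else 0) (by
      intro g g'
      funext t
      simp only [map_add, QuotientAddGroup.mk_add, Pi.add_apply]
      split_ifs <;> abel)
  have hj : ∀ g t, j g t = p t (r g) + if t.1 = 0 then ψ t.2 (g : G ⧸ H) else 0 :=
    fun g t => rfl
  refine ⟨j, (injective_iff_map_eq_zero j).2 fun g hg => ?_, fun i y hy => ?_⟩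
  · have hrg : r g = 0 := hp _ fun m a => by
      have := congrFun hg (m + 1, a)
      simpa [hj] using this
    have hgH : (g : G ⧸ H) = 0 := hψ _ fun a => by
      have := congrFun hg (0, a)
      simpa [hj, hrg] using this
    have hmem := (QuotientAddGroup.eq_zero_iff g).1 hgH
    have h1 : f ⟨g, hmem⟩ = 0 := (hr ⟨g, hmem⟩).symm.trans hrg
    exact congrArg Subtype.val ((map_eq_zero_iff f hf).1 h1)
  · refine mem_closure_pi_of_forall_dist_lt fun F ε hε => ?_
    obtain ⟨k, hk⟩ := hp' i F y (fun t => congrFun hy t) ε hε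
    refine ⟨_, ⟨k, rfl⟩, fun t ht => ?_⟩
    have h1 : ((x i k : G) : G ⧸ H) = 0 := (QuotientAddGroup.eq_zero_iff _).2 (hxH i k)
    have h2 : r (x i k) = f ⟨x i k, hxH i k⟩ := hr ⟨x i k, hxH i k⟩
    simp only [hj, h1, h2, map_zero, ite_self, add_zero]
    exact hk t ht

theorem compactSpace_completion_of_totallyBounded {X : Type*} [UniformSpace X]
    (h : TotallyBounded (Set.univ : Set X)) : CompactSpace (UniformSpace.Completion X) := by
  have h1 := (h.image (UniformSpace.Completion.uniformContinuous_coe X)).closure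
  rw [Set.image_univ, UniformSpace.Completion.denseRange_coe.closure_range] at h1
  exact ⟨h1.isCompact_of_isClosed isClosed_univ⟩

theorem isPrecompactHausdorffGroupTopology_induced {G C : Type*} [AddCommGroup G] [AddCommGroup C]
    [UniformSpace C] [IsUniformAddGroup C] [CompactSpace C] [T2Space C] {j : G →+ C}
    (hj : Function.Injective j) :
    IsPrecompactHausdorffGroupTopology (TopologicalSpace.induced j inferInstance) := by
  let u : UniformSpace G := UniformSpace.comap j inferInstance
  have hu : IsUniformAddGroup G := IsUniformAddGroup.comap j
  have hi : IsUniformInducing j := ⟨rfl⟩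
  refine @IsPrecompactHausdorffGroupTopology.mk G _ u.toTopologicalSpace inferInstance
    (T2Space.of_injective_continuous hj hi.uniformContinuous.continuous) ?_
  unfold IsPrecompactAddGroup
  rw [IsUniformAddGroup.rightUniformSpace_eq]
  refine compactSpace_completion_of_totallyBounded ?_
  exact totallyBounded_preimage hi isCompact_univ.totallyBounded

theorem exists_topology_closure_eq_zariskiClosure {G : Type*} [AddCommGroup G]
    (hG : #G ≤ 2 ^ continuum) {𝒳 : Set (Set G)} (h𝒳 : 𝒳.Countable) :
    ∃ T : TopologicalSpace G, IsPrecompactHausdorffGroupTopology T ∧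
      ∀ X ∈ 𝒳, closure[T] X = zariskiClosure X := by
  choose S hS hSX hXS using fun X : Set G => hasAlmostTorsionCover X
  have : Countable 𝒳 := h𝒳.to_subtype
  have : ∀ X, Countable (S X) := fun X => (hS X).countable.to_subtype
  obtain ⟨j, hj, hj'⟩ := exists_embedding_mem_closure hG (ι := Σ X : 𝒳, S X)
    (fun i => i.2.1.2.1) (fun i => i.2.1.2.2) fun i => (hSX i.1 i.2.1 i.2.2).2
  let T : TopologicalSpace G := TopologicalSpace.induced j inferInstance
  have hT : IsPrecompactHausdorffGroupTopology T := isPrecompactHausdorffGroupTopology_induced hj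
  refine ⟨T, hT, fun X hX => Set.Subset.antisymm ?_ fun z hz => ?_⟩
  · have := hT.isTopologicalAddGroup
    have := hT.t2Space
    exact closure_subset_zariskiClosure X
  · obtain ⟨i, hi, hzi⟩ := Set.mem_iUnion₂.1
      (HasAlmostTorsionCover.zariskiClosure_subset (hS X) (hXS X) hz)
    have h1 := hj' ⟨⟨X, hX⟩, ⟨i, hi⟩⟩ (j (z - i.1)) (by rw [← map_nsmul, hzi, map_zero])
    rw [closure_induced]
    have h2 : Set.MapsTo (fun y => j i.1 + y) (Set.range fun k => j (i.2.2 k)) (j '' X) := by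
      rintro _ ⟨k, rfl⟩
      exact ⟨_, (hSX X i hi).1 k, map_add j _ _⟩
    have h3 := h2.closure (by fun_prop) h1
    simpa using h3

end Embedding

theorem mainTheorem6 (G : Type*) [AddCommGroup G] :
    List.TFAE [
      Cardinal.mk G ≤ 2 ^ Cardinal.continuum,
      ∀ X : Set G, ∃ T : TopologicalSpace G, IsPrecompactHausdorffGroupTopology T ∧
        closure[T] X = zariskiClosure X,
      ∀ 𝒳 : Set (Set G), 𝒳.Countable →
        ∃ T : TopologicalSpace G, IsPrecompactHausdorffGroupTopology T ∧
          ∀ X ∈ 𝒳, closure[T] X = zariskiClosure X] := by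
  tfae_have 1 → 3 := fun hG 𝒳 h𝒳 => exists_topology_closure_eq_zariskiClosure hG h𝒳
  tfae_have 3 → 2 := fun h X => by
    obtain ⟨T, hT, hX⟩ := h {X} (Set.countable_singleton X)
    exact ⟨T, hT, hX X rfl⟩
  tfae_have 2 → 1 := fun h => mk_le_of_closure_eq_zariskiClosure fun X => by
    obtain ⟨T, hT, hX⟩ := h X
    exact ⟨T, hT.t2Space, hX⟩
  tfae_finish
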